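/- Let $G$ and $H$ be (finite-dimensional real, smooth) Lie groups with Lie algebras $\mathfrak{g}=T_1G$ and $\mathfrak{h}=T_1H$. A continuous one-parameter subgroup of $G$ is a continuous map $\gamma:\mathbb{R}\to G$ with $\gamma(0)=1$ and $\gamma(s+t)=\gamma(s)\gamma(t)$ for all $s,t\in\mathbb{R}$. Let $f:G\to H$ be a one-parameter-subgroup (OPS) homomorphism, that is, $f$ is a smooth map and for every continuous one-parameter subgroup $\gamma:\mathbb{R}\to G$ the composite $f\circ\gamma:\mathbb{R}\to H$ is a continuous one-parameter subgroup of $H$ (in particular $f(1)=1$). Then there exists a unique real-linear map $\mathcal{M}:\mathfrak{g}\to\mathfrak{h}$ such that $$f(\exp(x))=\exp(\mathcal{M}(x))\qquad\text{for all }x\in\mathfrak{g},$$ where $\exp$ denotes the exponential map of $G$ on the left and of $H$ on the right. Moreover, $\mathcal{M}$ is the differential $Df|_{1}:T_1G\to T_1H$ of $f$ at the identity. -/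

import Mathlib

open scoped Manifold ContDiff

noncomputable section

/-- A continuous one-parameter subgroup of a topological group. -/
structure IsOneParameterSubgroup {G : Type*} [TopologicalSpace G] [Group G] (γ : ℝ → G) :
    Prop where
  continuous : Continuous γ
  map_zero : γ 0 = 1
  map_add : ∀ s t : ℝ, γ (s + t) = γ s * γ t

section Morphisms

variable {E : Type*} [NormedAddCommGroup E] [NormedSpace ℝ E]
  {M : Type*} [TopologicalSpace M] (I : ModelWithCorners ℝ E M)
  {G : Type*} [TopologicalSpace G] [ChartedSpace M G] [Group G]
  {E' : Type*} [NormedAddCommGroup E'] [NormedSpace ℝ E']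
  {M' : Type*} [TopologicalSpace M'] (I' : ModelWithCorners ℝ E' M')
  {H : Type*} [TopologicalSpace H] [ChartedSpace M' H] [Group H]

/-- A one-parameter subgroup (OPS) homomorphism: a smooth map that sends every continuous
one-parameter subgroup of `G` to a continuous one-parameter subgroup of `H`. -/
structure IsOPSHom (f : G → H) : Prop where
  contMDiff : ContMDiff I I' ∞ f
  comp_isOneParameterSubgroup : ∀ γ : ℝ → G, IsOneParameterSubgroup γ →
    IsOneParameterSubgroup (f ∘ γ)

variable {I I'} in
/-- An OPS homomorphism maps the identity to the identity. -/
theorem IsOPSHom.map_one {f : G → H} (hf : IsOPSHom I I' f) : f 1 = 1 :=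
  (hf.comp_isOneParameterSubgroup (fun _ => 1) ⟨continuous_const, rfl, by simp⟩).map_zero

/-- The differential at the identity of a map `f : G → H` with `f 1 = 1`, as a linear map between
the Lie algebras `T₁G → T₁H`. It is `mfderiv I I' f 1 : T₁G → T_{f 1}H`, transported along the
equality `f 1 = 1`. -/
def differentialAtOne (f : G → H) (hf : f 1 = 1) :
    GroupLieAlgebra I G →L[ℝ] GroupLieAlgebra I' H :=
  Eq.rec (motive := fun y _ => GroupLieAlgebra I G →L[ℝ] TangentSpace I' y)
    (mfderiv I I' f (1 : G)) hf

theorem differentialAtOne_apply (f : G → H) (hf : f 1 = 1) (x : GroupLieAlgebra I G) :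
    differentialAtOne I I' f hf x = mfderiv I I' f (1 : G) x := by
  have key : ∀ (y z : H) (h : y = z) (A : GroupLieAlgebra I G →L[ℝ] TangentSpace I' y),
      (Eq.rec (motive := fun y _ => GroupLieAlgebra I G →L[ℝ] TangentSpace I' y) A h :
        GroupLieAlgebra I G →L[ℝ] TangentSpace I' z) x = A x := by
    intro y z h A
    subst h
    rfl
  exact key _ _ hf _

end Morphisms

section Exponential

variable {E : Type*} [NormedAddCommGroup E] [NormedSpace ℝ E]
  {M : Type*} [TopologicalSpace M] {I : ModelWithCorners ℝ E M}
  {G : Type*} [TopologicalSpace G] [ChartedSpace M G] [Group G] [LieGroup I ∞ G]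

theorem t2Space_of_lieGroup (I : ModelWithCorners ℝ E M) (G : Type*) [TopologicalSpace G]
    [ChartedSpace M G] [Group G] [LieGroup I ∞ G] : T2Space G := by
  have : IsTopologicalGroup G := topologicalGroup_of_lieGroup I ∞
  have : T1Space G := I.t1Space G
  infer_instance

theorem contMDiff_one_mulInvariantVectorField (x : GroupLieAlgebra I G) :
    ContMDiff I I.tangent 1
      (fun g : G => (⟨g, mulInvariantVectorField x g⟩ : TangentBundle I G)) := by
  have : LieGroup I (minSmoothness ℝ 3) G := by
    rw [minSmoothness_of_isRCLikeNormedField]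
    infer_instance
  have h := contMDiff_mulInvariantVectorField (I := I) (G := G) x
  refine h.of_le ?_
  rw [minSmoothness_of_isRCLikeNormedField]
  exact one_le_two

/-- Left-invariant vector fields are preserved by the differentials of left translations. -/
theorem mfderiv_mul_left_mulInvariantVectorField (x : GroupLieAlgebra I G) (g h : G) :
    mfderiv I I (fun b : G => g * b) h (mulInvariantVectorField x h) =
      mulInvariantVectorField x (g * h) := by
  have hd : ∀ a b : G, MDifferentiableAt I I (fun c : G => a * c) b := fun a b =>
    (contMDiff_mul_left (I := I) (n := ∞)).contMDiffAt.mdifferentiableAt (by simp)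
  have hc : (fun b : G => g * h * b) = (fun b : G => g * b) ∘ (fun b : G => h * b) := by
    ext b
    simp [mul_assoc]
  have e : mfderiv I I (fun b : G => g * h * b) 1 =
      (mfderiv I I (fun b : G => g * b) (h * 1)).comp (mfderiv I I (fun b : G => h * b) 1) := by
    rw [hc]
    exact mfderiv_comp (I' := I) (1 : G) (hd _ _) (hd _ _)
  have e' := congrArg (fun A => A x) e
  have key : ∀ k : G, k = h → mfderiv I I (fun b : G => g * b) h (mulInvariantVectorField x h) =
      mfderiv I I (fun b : G => g * b) k (mulInvariantVectorField x h) := by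
    rintro k rfl
    rfl
  exact (key _ (mul_one h)).trans e'.symm

/-- Left-invariant vector fields are complete. -/
theorem exists_isMIntegralCurve_mulInvariantVectorField [FiniteDimensional ℝ E]
    [BoundarylessManifold I G] (x : GroupLieAlgebra I G) :
    ∃ γ : ℝ → G, γ 0 = 1 ∧
      IsMIntegralCurve (I := I) γ (mulInvariantVectorField (I := I) (G := G) x) := by
  have : T2Space G := t2Space_of_lieGroup I G
  have : CompleteSpace E := FiniteDimensional.complete ℝ E
  have : IsManifold I 1 G := IsManifold.of_le (n := ∞) (by simp)
  have hv := contMDiff_one_mulInvariantVectorField x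
  obtain ⟨γ, h0, hγ⟩ := exists_isMIntegralCurveAt_of_contMDiffAt_boundaryless
    (t₀ := 0) (hv.contMDiffAt (x := (1 : G)))
  rw [isMIntegralCurveAt_iff'] at hγ
  obtain ⟨ε, hε, hγ⟩ := hγ
  rw [Real.ball_eq_Ioo, zero_sub, zero_add] at hγ
  refine exists_isMIntegralCurve_of_isMIntegralCurveOn hv hε (fun g => ?_) 1
  refine ⟨fun t => g * γ t, by simp [h0], fun t ht => ?_⟩
  have hd : MDifferentiableAt I I (fun c : G => g * c) (γ t) :=
    (contMDiff_mul_left (I := I) (n := ∞)).contMDiffAt.mdifferentiableAt (by simp)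
  have hc := hd.hasMFDerivAt.comp_hasMFDerivWithinAt t (hγ t ht)
  have e : (mfderiv I I (fun c : G => g * c) (γ t)).comp
      ((1 : ℝ →L[ℝ] ℝ).smulRight (mulInvariantVectorField (I := I) x (γ t))) =
      (1 : ℝ →L[ℝ] ℝ).smulRight (mulInvariantVectorField (I := I) x (g * γ t)) := by
    rw [← mfderiv_mul_left_mulInvariantVectorField x g (γ t)]
    ext
    simp
  rw [← e]
  exact hc

/-- Integral curves of left-invariant vector fields are determined by their value at `0`. -/
theorem isMIntegralCurve_mulInvariantVectorField_unique [FiniteDimensional ℝ E]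
    [BoundarylessManifold I G]
    (x : GroupLieAlgebra I G) {γ γ' : ℝ → G}
    (hγ : IsMIntegralCurve (I := I) γ (mulInvariantVectorField (I := I) (G := G) x))
    (hγ' : IsMIntegralCurve (I := I) γ' (mulInvariantVectorField (I := I) (G := G) x))
    (h : γ 0 = γ' 0) : γ = γ' := by
  have : T2Space G := t2Space_of_lieGroup I G
  have : CompleteSpace E := FiniteDimensional.complete ℝ E
  have : IsManifold I 1 G := IsManifold.of_le (n := ∞) (by simp)
  exact isMIntegralCurve_Ioo_eq_of_contMDiff_boundaryless
    (contMDiff_one_mulInvariantVectorField x) hγ hγ' h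

variable [FiniteDimensional ℝ E] [BoundarylessManifold I G]

/-- The exponential map `exp : 𝔤 → G` of a Lie group: `exp x = γ 1`, where `γ` is the (unique)
integral curve through the identity of the left-invariant vector field generated by `x`. -/
def lieExp (x : GroupLieAlgebra I G) : G :=
  Classical.choose (exists_isMIntegralCurve_mulInvariantVectorField x) 1

theorem lieExp_eq (x : GroupLieAlgebra I G) {γ : ℝ → G} (h0 : γ 0 = 1)
    (hγ : IsMIntegralCurve (I := I) γ (mulInvariantVectorField (I := I) (G := G) x)) :
    lieExp x = γ 1 := by
  have h := Classical.choose_spec (exists_isMIntegralCurve_mulInvariantVectorField x)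
  exact congrFun (isMIntegralCurve_mulInvariantVectorField_unique x h.2 hγ (h.1.trans h0.symm)) 1

end Exponential

end

open scoped Manifold ContDiff

section

variable {E : Type*} [NormedAddCommGroup E] [NormedSpace ℝ E]
  {M : Type*} [TopologicalSpace M] {I : ModelWithCorners ℝ E M}
  {G : Type*} [TopologicalSpace G] [ChartedSpace M G] [Group G]

/-! The curve `t ↦ exp (t x)` is a one-parameter subgroup with velocity `x` at 0, so `f` sends it to
a one-parameter subgroup, whose velocity at 0 is `Df|₁ x` by the chain rule. A one-parameter
subgroup differentiable at 0 is an integral curve of the left-invariant field of its initial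
velocity (`IsOneParameterSubgroup.isMIntegralCurve`), hence determined by that velocity; at time 1
this reads `f (exp x) = exp (Df|₁ x)`. Linearity comes for free, since the candidate is a
differential. Conversely, differentiating `f (exp (t x)) = exp (t L x)` at 0 forces `L = Df|₁`. -/

theorem mulInvariantVectorField_apply_one (x : GroupLieAlgebra I G) :
    mulInvariantVectorField x (1 : G) = x := by
  have h : HasMFDerivAt I I (fun c : G => 1 * c) 1 (ContinuousLinearMap.id ℝ E) :=
    (hasMFDerivAt_id (1 : G)).congr_of_eventuallyEq (.of_forall one_mul)
  exact congrArg (fun A : E →L[ℝ] E => A x) h.mfderiv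

variable [LieGroup I ∞ G]

/-- Left translates of integral curves of left-invariant vector fields are integral curves. -/
theorem IsMIntegralCurve.const_mul_mulInvariantVectorField {x : GroupLieAlgebra I G} {γ : ℝ → G}
    (hγ : IsMIntegralCurve (I := I) γ (mulInvariantVectorField (I := I) (G := G) x)) (g : G) :
    IsMIntegralCurve (I := I) (fun t => g * γ t)
      (mulInvariantVectorField (I := I) (G := G) x) := by
  intro t
  have hd : MDifferentiableAt I I (fun c : G => g * c) (γ t) :=
    (contMDiff_mul_left (I := I) (n := ∞)).contMDiffAt.mdifferentiableAt (by simp)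
  have hc := hd.hasMFDerivAt.comp t (hγ t)
  have e : (mfderiv I I (fun c : G => g * c) (γ t)).comp
      ((1 : ℝ →L[ℝ] ℝ).smulRight (mulInvariantVectorField (I := I) x (γ t))) =
      (1 : ℝ →L[ℝ] ℝ).smulRight (mulInvariantVectorField (I := I) x (g * γ t)) := by
    rw [← mfderiv_mul_left_mulInvariantVectorField x g (γ t)]
    ext
    simp
  rw [← e]
  exact hc

/-- An integral curve through the identity of a left-invariant vector field is a one-parameter
subgroup. -/
theorem IsMIntegralCurve.isOneParameterSubgroup [FiniteDimensional ℝ E]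
    [BoundarylessManifold I G] {x : GroupLieAlgebra I G} {γ : ℝ → G} (h0 : γ 0 = 1)
    (hγ : IsMIntegralCurve (I := I) γ (mulInvariantVectorField (I := I) (G := G) x)) :
    IsOneParameterSubgroup γ where
  continuous := continuous_iff_continuousAt.2 fun t => (hγ t).continuousAt
  map_zero := h0
  map_add s t := by
    -- For fixed `s`, both `t ↦ γ (t + s)` and `t ↦ γ s * γ t` are integral curves starting at `γ
    -- s`.
    have h := isMIntegralCurve_mulInvariantVectorField_unique x (hγ.comp_add s)
      (hγ.const_mul_mulInvariantVectorField (γ s)) (by simp [h0])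
    simpa [add_comm] using congrFun h t

/-- A one-parameter subgroup with velocity `v` at time `0` is an integral curve of the
left-invariant vector field generated by `v`. -/
theorem IsOneParameterSubgroup.isMIntegralCurve {γ : ℝ → G} (hγ : IsOneParameterSubgroup γ)
    {v : GroupLieAlgebra I G}
    (hv : HasMFDerivAt 𝓘(ℝ, ℝ) I γ 0 ((1 : ℝ →L[ℝ] ℝ).smulRight v : ℝ →L[ℝ] E)) :
    IsMIntegralCurve (I := I) γ (mulInvariantVectorField (I := I) (G := G) v) := by
  intro t
  -- Since `γ s = γ t * γ (s - t)`, the derivative at `t` is the one at 0 followed by that of left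
  -- translation by `γ t`. Reading tangent spaces as `E` lets `γ 0` be rewritten to `1`.
  have hd : HasMFDerivAt I I (fun c : G => γ t * c) (γ 0)
      (mfderiv I I (fun c : G => γ t * c) (1 : G) : E →L[ℝ] E) := by
    rw [hγ.map_zero]
    exact ((contMDiff_mul_left (I := I) (n := ∞)).contMDiffAt.mdifferentiableAt
      (by simp)).hasMFDerivAt
  have hs : HasMFDerivAt 𝓘(ℝ, ℝ) 𝓘(ℝ, ℝ) (fun s : ℝ => s - t) t (1 : ℝ →L[ℝ] ℝ) :=
    ((hasFDerivAt_id t).sub_const t).hasMFDerivAt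
  have h : HasMFDerivAt 𝓘(ℝ, ℝ) I (fun c : ℝ => γ t * γ c) (t - t)
      ((mfderiv I I (fun c : G => γ t * c) (1 : G) : E →L[ℝ] E).comp
        ((1 : ℝ →L[ℝ] ℝ).smulRight v : ℝ →L[ℝ] E)) := by
    rw [sub_self]
    exact hd.comp (0 : ℝ) hv
  have h' := HasMFDerivAt.comp (g := fun c : ℝ => γ t * γ c) (f := fun s : ℝ => s - t) t h hs
  have e : (fun c : ℝ => γ t * γ c) ∘ (fun s : ℝ => s - t) = γ := by
    ext s
    simp [← hγ.map_add]
  rw [e] at h'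
  refine h'.congr_mfderiv (ContinuousLinearMap.ext fun c : ℝ => ?_)
  exact map_smul (mfderiv I I (fun b : G => γ t * b) (1 : G) : E →L[ℝ] E) c v

variable [FiniteDimensional ℝ E] [BoundarylessManifold I G]

/-- The integral curve through the identity of the left-invariant vector field of `x` is
`t ↦ exp (t x)`. -/
theorem lieExp_smul_eq (x : GroupLieAlgebra I G) {γ : ℝ → G} (h0 : γ 0 = 1)
    (hγ : IsMIntegralCurve (I := I) γ (mulInvariantVectorField (I := I) (G := G) x)) (t : ℝ) :
    lieExp (t • x) = γ t := by
  -- Running `γ` at speed `t` scales its field by `t`; by linearity this is the left-invariant field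
  -- of `t • x`, so the time-one value is `γ t`.
  have h := hγ.comp_mul t
  have e : t • mulInvariantVectorField (I := I) (G := G) x =
      mulInvariantVectorField (I := I) (G := G) (t • x) := by
    ext g
    exact (map_smul (mfderiv I I (fun b : G => g * b) (1 : G)) t x).symm
  rw [e] at h
  simpa using lieExp_eq (t • x) (by simpa using h0) h

theorem isMIntegralCurve_lieExp_smul (x : GroupLieAlgebra I G) :
    IsMIntegralCurve (I := I) (fun t : ℝ => (lieExp (t • x) : G))
      (mulInvariantVectorField (I := I) (G := G) x) := by
  obtain ⟨γ, h0, hγ⟩ := exists_isMIntegralCurve_mulInvariantVectorField (G := G) x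
  simpa only [lieExp_smul_eq x h0 hγ] using hγ

theorem lieExp_zero_smul (x : GroupLieAlgebra I G) : (lieExp ((0 : ℝ) • x) : G) = 1 := by
  obtain ⟨γ, h0, hγ⟩ := exists_isMIntegralCurve_mulInvariantVectorField (G := G) x
  rw [lieExp_smul_eq x h0 hγ, h0]

/-- The curve `t ↦ exp (t x)` has velocity `x` at time `0`. -/
theorem hasMFDerivAt_lieExp_smul (x : GroupLieAlgebra I G) :
    HasMFDerivAt 𝓘(ℝ, ℝ) I (fun t : ℝ => (lieExp (t • x) : G)) 0
      ((1 : ℝ →L[ℝ] ℝ).smulRight x : ℝ →L[ℝ] E) := by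
  have e : (mulInvariantVectorField (I := I) x (lieExp ((0 : ℝ) • x) : G) : E) = x := by
    rw [lieExp_zero_smul]
    exact mulInvariantVectorField_apply_one x
  exact (isMIntegralCurve_lieExp_smul (G := G) x 0).congr_mfderiv
    (congrArg (fun v : E => (1 : ℝ →L[ℝ] ℝ).smulRight v) e)

end

section

variable {E : Type*} [NormedAddCommGroup E] [NormedSpace ℝ E] [FiniteDimensional ℝ E]
  {M : Type*} [TopologicalSpace M] {I : ModelWithCorners ℝ E M}
  {G : Type*} [TopologicalSpace G] [ChartedSpace M G] [Group G] [LieGroup I ∞ G]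
  [BoundarylessManifold I G]
  {E' : Type*} [NormedAddCommGroup E'] [NormedSpace ℝ E']
  {M' : Type*} [TopologicalSpace M'] {I' : ModelWithCorners ℝ E' M'}
  {H : Type*} [TopologicalSpace H] [ChartedSpace M' H] [Group H]

/-- Chain rule at `exp 0 = 1`. Both the existence and the uniqueness of the linear map rest on this
velocity. -/
theorem IsOPSHom.hasMFDerivAt_comp_lieExp_smul {f : G → H} (hf : IsOPSHom I I' f)
    (x : GroupLieAlgebra I G) :
    HasMFDerivAt 𝓘(ℝ, ℝ) I' (f ∘ fun t : ℝ => (lieExp (t • x) : G)) 0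
      ((1 : ℝ →L[ℝ] ℝ).smulRight (differentialAtOne I I' f hf.map_one x) : ℝ →L[ℝ] E') := by
  have hd : HasMFDerivAt I I' f (lieExp ((0 : ℝ) • x) : G)
      (mfderiv I I' f (1 : G) : E →L[ℝ] E') := by
    rw [lieExp_zero_smul]
    exact (hf.contMDiff.contMDiffAt.mdifferentiableAt (by simp)).hasMFDerivAt
  have h := HasMFDerivAt.comp (f := fun t : ℝ => (lieExp (t • x) : G)) (0 : ℝ) hd
    (hasMFDerivAt_lieExp_smul x)
  refine h.congr_mfderiv (ContinuousLinearMap.ext fun c : ℝ => ?_)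
  refine (map_smul (mfderiv I I' f (1 : G) : E →L[ℝ] E') c x).trans ?_
  exact congrArg (fun v : E' => c • v) (differentialAtOne_apply I I' f hf.map_one x).symm

variable [FiniteDimensional ℝ E'] [LieGroup I' ∞ H] [BoundarylessManifold I' H]

/-- An OPS homomorphism intertwines the exponential maps through its differential at `1`. -/
theorem IsOPSHom.map_lieExp {f : G → H} (hf : IsOPSHom I I' f) (x : GroupLieAlgebra I G) :
    f (lieExp x) = lieExp (differentialAtOne I I' f hf.map_one x) := by
  have h := hf.comp_isOneParameterSubgroup _
    ((isMIntegralCurve_lieExp_smul x).isOneParameterSubgroup (lieExp_zero_smul x))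
  have h' := lieExp_eq _ h.map_zero (h.isMIntegralCurve (hf.hasMFDerivAt_comp_lieExp_smul x))
  simpa using h'.symm

/-- A linear map through which an OPS homomorphism intertwines the exponential maps is its
differential at `1`. -/
theorem IsOPSHom.eq_differentialAtOne {f : G → H} (hf : IsOPSHom I I' f)
    (L : GroupLieAlgebra I G →ₗ[ℝ] GroupLieAlgebra I' H)
    (hL : ∀ x : GroupLieAlgebra I G, f (lieExp x) = lieExp (L x)) :
    L = (differentialAtOne I I' f hf.map_one).toLinearMap := by
  ext x
  have h := hf.hasMFDerivAt_comp_lieExp_smul x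
  -- Only the homogeneity of `L` is needed here: `L (t • x) = t • L x`.
  have e : (f ∘ fun t : ℝ => (lieExp (t • x) : G)) = fun t : ℝ => (lieExp (t • L x) : H) := by
    ext t
    simp [hL]
  rw [e] at h
  have h' := hasMFDerivAt_unique (hasMFDerivAt_lieExp_smul (G := H) (L x)) h
  have h1 := congrArg (fun A : ℝ →L[ℝ] E' => A 1) h'
  exact (one_smul ℝ (L x)).symm.trans (h1.trans (one_smul ℝ _))

end

theorem theoremA3
    {E : Type*} [NormedAddCommGroup E] [NormedSpace ℝ E] [FiniteDimensional ℝ E]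
    {M : Type*} [TopologicalSpace M] {I : ModelWithCorners ℝ E M}
    {G : Type*} [TopologicalSpace G] [ChartedSpace M G] [Group G] [LieGroup I ∞ G]
    [BoundarylessManifold I G]
    {E' : Type*} [NormedAddCommGroup E'] [NormedSpace ℝ E'] [FiniteDimensional ℝ E']
    {M' : Type*} [TopologicalSpace M'] {I' : ModelWithCorners ℝ E' M'}
    {H : Type*} [TopologicalSpace H] [ChartedSpace M' H] [Group H] [LieGroup I' ∞ H]
    [BoundarylessManifold I' H]
    (f : G → H) (hf : IsOPSHom I I' f) :
    (∃! L : GroupLieAlgebra I G →ₗ[ℝ] GroupLieAlgebra I' H,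
      ∀ x : GroupLieAlgebra I G, f (lieExp x) = lieExp (L x)) ∧
    ∀ L : GroupLieAlgebra I G →ₗ[ℝ] GroupLieAlgebra I' H,
      (∀ x : GroupLieAlgebra I G, f (lieExp x) = lieExp (L x)) →
        L = (differentialAtOne I I' f hf.map_one).toLinearMap := by
  exact ⟨⟨_, hf.map_lieExp, fun L hL => hf.eq_differentialAtOne L hL⟩,
    fun L hL => hf.eq_differentialAtOne L hL⟩
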